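/- **Theorem 1.2.** For an integer $n\ge 1$ let $T_n$ be the poset whose elements are $a_1,\dots,a_{2n+21}$ and $b_1,\dots,b_{2n+20}$ and whose order is generated by the relations - $a_1<a_2<\cdots<a_{2n+21}$ and $b_1<b_2<\cdots<b_{2n+20}$; - $a_k<b_{k+1}$ for every even $k$ with $2\le k\le 2n+18$ and for $k\in\{1,3,9\}$; - $b_k<a_{k+2}$ for every even $k$ with $2\le k\le 2n+18$ and for $k\in\{2n+11,\,2n+17,\,2n+19\}$. (Its Hasse diagram contains, for $1\le m\le n$, a trapezoid with corners $a_{2m+8},\,b_{2m+9},\,b_{2m+10},\,a_{2m+12}$; the rest of the diagram consists of two fixed end pieces, exchanged by the order-reversing symmetry $a_i\mapsto a_{2n+22-i}$, $b_j\mapsto b_{2n+21-j}$.) For a finite nonempty poset $P$ let $\mathbb P(x\prec y)$ be the probability that $x$ strictly precedes $y$ in a uniformly random linear extension of $P$ (so $\mathbb P(x\prec x)=0$), and let $$\delta(P)=\max_{(x,y)\in P^2}\min\{\mathbb P(x\prec y),\,\mathbb P(y\prec x)\}$$ be its balance constant. Define $(a_m,b_m)_{m\ge1}$ (numbers, not the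 elements above) by $(a_1,b_1)=(19212,35784)$, $a_{m+1}=3a_m+3b_m$, $b_{m+1}=4a_m+6b_m$. Then: 1. for every $n\ge 1$ the poset $T_n$ has width $2$ (its largest antichain has two elements), and it is the disjoint union of a chain with $2n+21$ elements and a chain with $2n+20$ elements; 2. for every $n\ge 1$, $$\delta(T_n)=\frac{5781\,a_{n+1}+6702\,b_{n+1}}{16572\,a_{n+1}+19212\,b_{n+1}};$$ 3. $\displaystyle\lim_{n\to\infty}\delta(T_n)=\beta=\frac{5864893+27\sqrt{57}}{16812976}$, and $0.348843<\beta<0.348844$. -/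

import Mathlib

/-- The linear extensions of a poset `P`, as (reflexive) linear order relations on `P` that contain
the order of `P`. -/
def linearExtensions (P : Type*) [PartialOrder P] : Set (P → P → Prop) :=
  {r | IsLinearOrder P r ∧ ∀ x y, x ≤ y → r x y}

/-- The probability that `x` strictly precedes `y` in a uniformly random linear extension of the
finite poset `P`; it is `0` for `x = y`. -/
noncomputable def probPrec {P : Type*} [PartialOrder P] [Finite P] (x y : P) : ℝ :=
  ({r ∈ linearExtensions P | x ≠ y ∧ r x y}.ncard : ℝ) / ((linearExtensions P).ncard : ℝ)

/-- The balance constant `δ(P)`: the maximum over all pairs `(x, y)` of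
`min {ℙ(x ≺ y), ℙ(y ≺ x)}`. -/
noncomputable def balanceConstant (P : Type*) [PartialOrder P] [Fintype P] [Nonempty P] : ℝ :=
  (Finset.univ : Finset (P × P)).sup' Finset.univ_nonempty
    fun p => min (probPrec p.1 p.2) (probPrec p.2 p.1)

/-- `P` has width `k`: the largest cardinality of a finite antichain of `P` is `k`. -/
def HasWidth (P : Type*) [PartialOrder P] (k : ℕ) : Prop :=
  IsGreatest {m : ℕ | ∃ s : Finset P, IsAntichain (· ≤ ·) (s : Set P) ∧ s.card = m} k

/-- The underlying set of the poset `T_n`: the elements `a_1, …, a_{2n+21}` of the long chain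
(`a_i` is `Sum.inl` of `i - 1`) and `b_1, …, b_{2n+20}` of the short chain
(`b_j` is `Sum.inr` of `j - 1`). -/
def TrapezoidPoset (n : ℕ) : Type := Fin (2 * n + 21) ⊕ Fin (2 * n + 20)

namespace TrapezoidPoset

instance (n : ℕ) : Fintype (TrapezoidPoset n) :=
  inferInstanceAs (Fintype (Fin (2 * n + 21) ⊕ Fin (2 * n + 20)))

instance (n : ℕ) : Nonempty (TrapezoidPoset n) :=
  inferInstanceAs (Nonempty (Fin (2 * n + 21) ⊕ Fin (2 * n + 20)))

/-- The indices `k` for which the Hasse diagram of `T_n` has an edge `a_k < b_{k+1}`.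
For `1 ≤ m ≤ n` the edges `a_{2m+8} < b_{2m+9}` (from here) and `b_{2m+10} < a_{2m+12}`
(from `DownEdge`) are the two slanted sides of the `m`-th trapezoid, whose other two sides are
the chain segments from `a_{2m+8}` to `a_{2m+12}` and from `b_{2m+9}` to `b_{2m+10}`. -/
def UpEdge (n k : ℕ) : Prop :=
  (Even k ∧ 2 ≤ k ∧ k ≤ 2 * n + 18) ∨ k = 1 ∨ k = 3 ∨ k = 9

/-- The indices `k` for which the Hasse diagram of `T_n` has an edge `b_k < a_{k+2}`.
This is the image of `UpEdge` under the order-reversing symmetry `a_i ↦ a_{2n+22-i}`,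
`b_j ↦ b_{2n+21-j}`. -/
def DownEdge (n k : ℕ) : Prop :=
  (Even k ∧ 2 ≤ k ∧ k ≤ 2 * n + 18) ∨ k = 2 * n + 11 ∨ k = 2 * n + 17 ∨ k = 2 * n + 19

/-- The order generated by `a_1 < a_2 < ⋯`, `b_1 < b_2 < ⋯`, `a_k < b_{k+1}` for `UpEdge n k` and
`b_k < a_{k+2}` for `DownEdge n k`. Between the chains this reads: `a_i ≤ b_j` iff some edge
`a_k < b_{k+1}` has `i ≤ k` and `k + 1 ≤ j`, and `b_j ≤ a_i` iff some edge `b_k < a_{k+2}` has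
`j ≤ k` and `k + 2 ≤ i`. -/
def Le (n : ℕ) : TrapezoidPoset n → TrapezoidPoset n → Prop
  | Sum.inl i, Sum.inl i' => i ≤ i'
  | Sum.inr j, Sum.inr j' => j ≤ j'
  | Sum.inl i, Sum.inr j => ∃ k, UpEdge n k ∧ (i : ℕ) + 1 ≤ k ∧ k + 1 ≤ (j : ℕ) + 1
  | Sum.inr j, Sum.inl i => ∃ k, DownEdge n k ∧ (j : ℕ) + 1 ≤ k ∧ k + 2 ≤ (i : ℕ) + 1

instance (n : ℕ) : PartialOrder (TrapezoidPoset n) where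
  le := Le n
  le_refl x := by rcases x with i | j <;> exact le_refl _
  le_trans x y z hxy hyz := by
    rcases x with x | x <;> rcases y with y | y <;> rcases z with z | z <;>
      simp only [Le, Fin.le_def] at hxy hyz ⊢
    · omega
    · obtain ⟨k, hk, h1, h2⟩ := hyz
      exact ⟨k, hk, by omega, by omega⟩
    · obtain ⟨k, hk, h1, h2⟩ := hxy
      obtain ⟨l, hl, h3, h4⟩ := hyz
      omega
    · obtain ⟨k, hk, h1, h2⟩ := hxy
      exact ⟨k, hk, by omega, by omega⟩
    · obtain ⟨k, hk, h1, h2⟩ := hxy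
      exact ⟨k, hk, by omega, by omega⟩
    · obtain ⟨k, hk, h1, h2⟩ := hxy
      obtain ⟨l, hl, h3, h4⟩ := hyz
      omega
    · obtain ⟨k, hk, h1, h2⟩ := hyz
      exact ⟨k, hk, by omega, by omega⟩
    · omega
  le_antisymm x y hxy hyx := by
    rcases x with x | x <;> rcases y with y | y <;>
      simp only [Le] at hxy hyx
    · exact congrArg Sum.inl (le_antisymm hxy hyx)
    · obtain ⟨k, hk, h1, h2⟩ := hxy
      obtain ⟨l, hl, h3, h4⟩ := hyx
      omega
    · obtain ⟨k, hk, h1, h2⟩ := hxy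
      obtain ⟨l, hl, h3, h4⟩ := hyx
      omega
    · exact congrArg Sum.inr (le_antisymm hxy hyx)

end TrapezoidPoset

/-! A linear extension of the poset is determined by the numbers `f j` of long-chain elements
preceding `b_{j+1}`. These numbers form a weakly increasing sequence, and the cross relations say
exactly that each `f j` lies in an interval of three or four integers (`mem_window_iff`). So linear
extensions are monotone sequences through windows (`mergeRel_mem`, `mergeRel_injOn`,
`exists_mergeRel`), and they are counted by transfer matrices: the number with a prescribed `f j` is
a forward count times a backward count (`card_windowSeqs_eq_at`).

For elements of different chains, the two order probabilities are the two parts of a row of such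
products (`slotRow`) cut at one place, divided by the total. Hence the balance constant is the
largest minimum of the two parts over all rows and cuts.

The rows are explicit. The lower end piece produces the vector `(19212, 35784)`, each trapezoid
applies the matrix with rows `(3, 3)` and `(4, 6)`, and the upper end piece mirrors the lower one.
The last row, for `a_{2n+21}` and `b_{2n+20}`, attains the claimed value. Every other cut has a part
no larger: in the end rows by inequalities linear in `a (n + 1)` and `b (n + 1)`, in the middle rows
by bilinear ones, both using `7/4 ≤ b/a ≤ 2` (`RowRecursion.bounds`). The limit follows from
convergence of `b/a` to the dominant eigendirection of the matrix. -/

/-! ### Monotone sequences through windows, counted by their last value -/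

/-- The monotone sequences `f 0 ≤ ⋯ ≤ f k` of natural numbers with `f i ∈ W i` for all `i`. -/
noncomputable def windowSeqs (W : ℕ → Finset ℕ) (k : ℕ) : Finset (Fin (k + 1) → ℕ) :=
  open Classical in {f ∈ Fintype.piFinset fun i : Fin (k + 1) => W i | Monotone f}

theorem mem_windowSeqs {W : ℕ → Finset ℕ} {k : ℕ} {f : Fin (k + 1) → ℕ} :
    f ∈ windowSeqs W k ↔ (∀ i : Fin (k + 1), f i ∈ W i) ∧ Monotone f := by
  simp [windowSeqs]

/-- The number of sequences in `windowSeqs W k` that end in `y`. -/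
noncomputable def endCount (W : ℕ → Finset ℕ) (k y : ℕ) : ℕ :=
  {f ∈ windowSeqs W k | f (Fin.last k) = y}.card

open Finset in
theorem endCount_zero {W : ℕ → Finset ℕ} {y : ℕ} (hy : y ∈ W 0) : endCount W 0 y = 1 := by
  rw [endCount, card_eq_one]
  refine ⟨fun _ => y, ?_⟩
  ext f
  simp only [mem_filter, mem_windowSeqs, mem_singleton]
  constructor
  · rintro ⟨-, h⟩
    funext i
    rw [← h]
    exact congrArg f (Fin.eq_zero i)
  · rintro rfl
    refine ⟨⟨fun i => ?_, monotone_const⟩, rfl⟩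
    have : i = 0 := Fin.eq_zero i
    simpa [this] using hy

theorem card_windowSeqs_eq_sum (W : ℕ → Finset ℕ) (k : ℕ) :
    (windowSeqs W k).card = ∑ y ∈ W k, endCount W k y :=
  Finset.card_eq_sum_card_fiberwise fun f hf => by
    simpa using (mem_windowSeqs.1 hf).1 (Fin.last k)

/-- Deleting the last term is a bijection onto the shorter sequences whose final value is at most
`y`. -/
theorem endCount_succ {W : ℕ → Finset ℕ} {k y : ℕ} (hy : y ∈ W (k + 1)) :
    endCount W (k + 1) y = ∑ x ∈ W k with x ≤ y, endCount W k x := by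
  have h1 : ((windowSeqs W k).filter fun g => g (Fin.last k) ≤ y).card =
      ∑ x ∈ W k with x ≤ y, endCount W k x := by
    rw [Finset.card_eq_sum_card_fiberwise (f := fun g => g (Fin.last k))
      (t := (W k).filter fun x => x ≤ y)]
    · refine Finset.sum_congr rfl fun x hx => ?_
      rw [endCount, Finset.filter_filter]
      congr 1
      refine Finset.filter_congr fun g _ => ?_
      have := (Finset.mem_filter.1 hx).2
      constructor
      · exact fun h => h.2
      · exact fun h => ⟨h ▸ this, h⟩
    · intro g hg
      have hg := Finset.mem_filter.1 (Finset.mem_coe.1 hg)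
      have := (mem_windowSeqs.1 hg.1).1 (Fin.last k)
      simpa using ⟨this, hg.2⟩
  rw [← h1, endCount]
  refine Finset.card_bij' (fun f _ => Fin.init f) (fun g _ => Fin.snoc (α := fun _ => ℕ) g y)
    ?_ ?_ ?_ ?_
  · intro f hf
    obtain ⟨hf, hl⟩ := Finset.mem_filter.1 hf
    obtain ⟨hW, hm⟩ := mem_windowSeqs.1 hf
    refine Finset.mem_filter.2 ⟨mem_windowSeqs.2 ⟨fun i => ?_, fun i i' h => ?_⟩, ?_⟩
    · simpa [Fin.init] using hW i.castSucc
    · exact hm (Fin.castSucc_le_castSucc_iff.2 h)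
    · rw [← hl]
      exact hm (Fin.le_last _)
  · intro g hg
    obtain ⟨hg, hl⟩ := Finset.mem_filter.1 hg
    obtain ⟨hW, hm⟩ := mem_windowSeqs.1 hg
    refine Finset.mem_filter.2 ⟨mem_windowSeqs.2 ⟨fun i => ?_, ?_⟩, by simp⟩
    · refine Fin.lastCases ?_ (fun i => ?_) i
      · simpa using hy
      · simpa using hW i
    · intro i i'
      refine Fin.lastCases ?_ (fun i => ?_) i <;> refine Fin.lastCases ?_ (fun i' => ?_) i'
      · simp
      · intro h
        exact absurd h (not_le.2 (Fin.castSucc_lt_last i'))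
      · intro _
        simpa using (hm (Fin.le_last i)).trans hl
      · intro h
        simpa using hm (Fin.castSucc_le_castSucc_iff.1 h)
  · intro f hf
    obtain ⟨-, hl⟩ := Finset.mem_filter.1 hf
    rw [← hl]
    exact Fin.snoc_init_self f
  · intro g _
    exact Fin.init_snoc (α := fun _ => ℕ) y g

/-! ### Interval windows: forward and backward transfer counts -/

/-- The window sequence whose `j`-th member is the interval of length `len j` starting at `lo j`. -/
def window (lo len : ℕ → ℕ) (j : ℕ) : Finset ℕ := Finset.Ico (lo j) (lo j + len j)

theorem sum_window (lo len : ℕ → ℕ) (j : ℕ) (F : ℕ → ℕ) :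
    ∑ y ∈ window lo len j, F y = ∑ i ∈ Finset.range (len j), F (lo j + i) := by
  rw [window, Finset.sum_Ico_eq_sum_range, Nat.add_sub_cancel_left]

theorem mem_window {lo len : ℕ → ℕ} {j i : ℕ} (h : i < len j) :
    lo j + i ∈ window lo len j := by
  simp [window, h]

/-- `fwdCount lo len j i` counts the monotone sequences of length `j + 1` in the windows
that end in `lo j + i`. -/
def fwdCount (lo len : ℕ → ℕ) : ℕ → ℕ → ℕ
  | 0, _ => 1
  | j + 1, i => ∑ k ∈ Finset.range (len j),
      if lo j + k ≤ lo (j + 1) + i then fwdCount lo len j k else 0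

/-- `bwdCount lo len s j i` counts the monotone continuations through the `s` windows after the
`j`-th one of a sequence that has reached `lo j + i`. -/
def bwdCount (lo len : ℕ → ℕ) : ℕ → ℕ → ℕ → ℕ
  | 0, _, _ => 1
  | s + 1, j, i => ∑ k ∈ Finset.range (len (j + 1)),
      if lo j + i ≤ lo (j + 1) + k then bwdCount lo len s (j + 1) k else 0

theorem endCount_window (lo len : ℕ → ℕ) (j i : ℕ) (hi : i < len j) :
    endCount (window lo len) j (lo j + i) = fwdCount lo len j i := by
  induction j generalizing i with
  | zero => exact endCount_zero (mem_window hi)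
  | succ j ih =>
    rw [endCount_succ (mem_window hi), Finset.sum_filter, sum_window, fwdCount]
    refine Finset.sum_congr rfl fun k hk => ?_
    rw [ih k (Finset.mem_range.1 hk)]

/-- The weights `V` are left arbitrary so that the identity also applies to end counts of a window
sequence altered at position `j`. Each step backwards exchanges two sums. -/
theorem sum_transfer (lo len : ℕ → ℕ) (V : ℕ → ℕ → ℕ) (j s : ℕ)
    (hV : ∀ k, j ≤ k → k < j + s → ∀ y ∈ window lo len (k + 1),
      V (k + 1) y = ∑ x ∈ window lo len k with x ≤ y, V k x) :
    ∑ y ∈ window lo len (j + s), V (j + s) y =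
      ∑ i ∈ Finset.range (len j), V j (lo j + i) * bwdCount lo len s j i := by
  induction s generalizing j with
  | zero => simp [sum_window, bwdCount]
  | succ s ih =>
    have h := ih (j + 1) fun k h1 h2 => hV k (by omega) (by omega)
    rw [show j + 1 + s = j + (s + 1) by ring] at h
    rw [h]
    calc _ = ∑ k ∈ Finset.range (len (j + 1)), ∑ i ∈ Finset.range (len j),
          (if lo j + i ≤ lo (j + 1) + k then V j (lo j + i) else 0) *
            bwdCount lo len s (j + 1) k := by
          refine Finset.sum_congr rfl fun k hk => ?_
          rw [hV j le_rfl (by omega) _ (mem_window (Finset.mem_range.1 hk)), Finset.sum_filter,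
            sum_window, Finset.sum_mul]
      _ = _ := by
          rw [Finset.sum_comm]
          refine Finset.sum_congr rfl fun i _ => ?_
          rw [bwdCount, Finset.mul_sum]
          refine Finset.sum_congr rfl fun k _ => ?_
          split_ifs <;> simp

/-- The number of sequences through the windows that take a given value at position `j`. -/
theorem card_windowSeqs_eq_at (lo len : ℕ → ℕ) (j s i : ℕ) (hi : i < len j) :
    ((windowSeqs (window lo len) (j + s)).filter
      fun f => f ⟨j, by omega⟩ = lo j + i).card =
      fwdCount lo len j i * bwdCount lo len s j i := by
  classical
  set W := window lo len with hW
  -- Prescribing the value at `j` amounts to shrinking window `j` to one point. End counts are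
  -- unchanged up to that point, and from there on the transfer is the old one.
  set W' := Function.update W j {lo j + i} with hW'
  have e1 : (windowSeqs W (j + s)).filter (fun f => f ⟨j, by omega⟩ = lo j + i) =
      windowSeqs W' (j + s) := by
    ext f
    simp only [Finset.mem_filter, mem_windowSeqs]
    constructor
    · rintro ⟨⟨h1, h2⟩, h3⟩
      refine ⟨fun k => ?_, h2⟩
      by_cases hk : (k : ℕ) = j
      · have : k = ⟨j, by omega⟩ := Fin.ext hk
        rw [this, h3]
        simp [hW']
      · simpa [hW', hk] using h1 k
    · rintro ⟨h1, h2⟩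
      have h3 : f ⟨j, by omega⟩ = lo j + i := by simpa [hW'] using h1 ⟨j, by omega⟩
      refine ⟨⟨fun k => ?_, h2⟩, h3⟩
      by_cases hk : (k : ℕ) = j
      · have : k = ⟨j, by omega⟩ := Fin.ext hk
        rw [this, h3]
        exact mem_window hi
      · simpa [hW', hk] using h1 k
  have ne : ∀ k, k ≠ j → W' k = W k := fun k hk => Function.update_of_ne hk _ _
  have self : W' j = {lo j + i} := Function.update_self _ _ _
  have pre : ∀ k y, k < j → endCount W' k y = endCount W k y := by
    intro k y hk
    have : windowSeqs W' k = windowSeqs W k := by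
      ext f
      simp only [mem_windowSeqs]
      refine and_congr_left fun _ => forall_congr' fun l => ?_
      rw [ne l (by omega)]
    rw [endCount, endCount, this]
  have atj : endCount W' j (lo j + i) = endCount W j (lo j + i) := by
    cases j with
    | zero => rw [endCount_zero (by simp [self]), endCount_zero (mem_window hi)]
    | succ j =>
      rw [endCount_succ (by simp [self]), endCount_succ (mem_window hi), ne j (by omega)]
      exact Finset.sum_congr rfl fun x _ => pre j x (by omega)
  have atj' : ∀ x, x ≠ lo j + i → endCount W' j x = 0 := by
    intro x hx
    rw [endCount, Finset.card_eq_zero, Finset.filter_eq_empty_iff]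
    intro f hf h
    have := (mem_windowSeqs.1 hf).1 (Fin.last j)
    rw [h] at this
    simp [self] at this
    exact hx this
  have sub : ∀ k, W' k ⊆ W k := by
    intro k
    by_cases hk : k = j
    · subst hk
      rw [self, Finset.singleton_subset_iff]
      exact mem_window hi
    · rw [ne k hk]
  rw [e1, card_windowSeqs_eq_sum]
  -- At `k = j` the sum may run over the full old window, since the new end count vanishes off the
  -- chosen point.
  have key := sum_transfer lo len (fun k => endCount W' k) j s (by
    intro k h1 h2 y hy
    rw [endCount_succ (by rw [ne (k + 1) (by omega)]; exact hy)]
    by_cases hk : k = j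
    · subst hk
      refine Finset.sum_subset (Finset.filter_subset_filter _ (sub k)) fun x hx hx' => atj' x ?_
      rintro rfl
      exact hx' (by simpa [self] using (Finset.mem_filter.1 hx).2)
    · rw [ne k hk])
  have e2 : ∑ y ∈ W' (j + s), endCount W' (j + s) y =
      ∑ y ∈ window lo len (j + s), endCount W' (j + s) y := by
    by_cases hs : s = 0
    · subst hs
      refine Finset.sum_subset (sub _) fun x _ hx' => atj' x ?_
      rintro rfl
      exact hx' (by simp [self])
    · rw [ne _ (by omega)]
  rw [e2]
  refine key.trans ?_
  rw [Finset.sum_eq_single_of_mem i (Finset.mem_range.2 hi), atj, endCount_window _ _ _ _ hi]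
  intro k _ hk
  change endCount W' j (lo j + k) * _ = 0
  rw [atj' _ (by omega), zero_mul]

theorem card_windowSeqs_filter_at (lo len : ℕ → ℕ) (j s : ℕ) (p : ℕ → Prop) [DecidablePred p] :
    ((windowSeqs (window lo len) (j + s)).filter fun f => p (f ⟨j, by omega⟩)).card =
      ∑ i ∈ Finset.range (len j), if p (lo j + i) then
        fwdCount lo len j i * bwdCount lo len s j i else 0 := by
  rw [Finset.card_eq_sum_card_fiberwise (f := fun f => f ⟨j, by omega⟩) (t := window lo len j),
    sum_window]
  · refine Finset.sum_congr rfl fun i hi => ?_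
    rw [Finset.filter_filter]
    split_ifs with h
    · rw [← card_windowSeqs_eq_at lo len j s i (Finset.mem_range.1 hi)]
      congr 1
      refine Finset.filter_congr fun f _ => ?_
      constructor
      · exact fun h => h.2
      · exact fun h' => ⟨h' ▸ h, h'⟩
    · rw [Finset.card_eq_zero, Finset.filter_eq_empty_iff]
      rintro f - ⟨h1, h2⟩
      exact h (h2 ▸ h1)
  · intro f hf
    have hf := Finset.mem_filter.1 (Finset.mem_coe.1 hf)
    exact (mem_windowSeqs.1 hf.1).1 ⟨j, by omega⟩

/-! ### Linear extensions as window sequences -/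

namespace TrapezoidPoset

variable {n : ℕ}

/-- The number of elements of the long chain that lie below `b_{j+1}`. -/
def lower (j : ℕ) : ℕ := if j % 2 = 0 ∨ j = 1 ∨ j = 3 ∨ j = 9 then j else j - 1

/-- The number of elements of the long chain that do not lie above `b_{j+1}`, minus the number of
those below it, plus one. -/
def size (n j : ℕ) : ℕ :=
  (if j % 2 = 0 ∧ j ≠ 2 * n + 10 ∧ j ≠ 2 * n + 16 ∧ j ≠ 2 * n + 18 then j + 4
    else j + 3) - lower j

/-- The relation on `T_n` that puts `f j` elements of the long chain before `b_{j+1}`. -/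
def mergeRel (f : Fin (2 * n + 20) → ℕ) : TrapezoidPoset n → TrapezoidPoset n → Prop
  | Sum.inl i, Sum.inl i' => i ≤ i'
  | Sum.inr j, Sum.inr j' => j ≤ j'
  | Sum.inl i, Sum.inr j => (i : ℕ) < f j
  | Sum.inr j, Sum.inl i => f j ≤ i

/-- The bounds come from the nearest edges: the largest `k ≤ j` with an edge `a_k < b_{k+1}`, and
the smallest `k ≥ j + 1` with an edge `b_k < a_{k+2}`. The latter is `j + 1` or `j + 2`, which
explains `j + 3` and `j + 4` in `size`. -/
theorem mem_window_iff (j : Fin (2 * n + 20)) (y : ℕ) :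
    y ∈ window lower (size n) j ↔ y ≤ 2 * n + 21 ∧
      (∀ i : Fin (2 * n + 21), Le n (Sum.inl i) (Sum.inr j) → (i : ℕ) < y) ∧
      (∀ i : Fin (2 * n + 21), Le n (Sum.inr j) (Sum.inl i) → y ≤ (i : ℕ)) := by
  obtain ⟨j, hj⟩ := j
  simp only [window, Finset.mem_Ico, Le, UpEdge, DownEdge, Nat.even_iff]
  constructor
  · rintro ⟨h1, h2⟩
    refine ⟨?_, ?_, ?_⟩
    · simp only [lower, size] at h1 h2
      split_ifs at h1 h2 <;> omega
    · rintro ⟨i, hi⟩ ⟨k, hk, h3, h4⟩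
      simp only at h3 h4 ⊢
      simp only [lower] at h1
      split_ifs at h1 <;> omega
    · rintro ⟨i, hi⟩ ⟨k, hk, h3, h4⟩
      simp only at h3 h4 ⊢
      simp only [lower, size] at h1 h2
      split_ifs at h1 h2 <;> omega
  · rintro ⟨h0, h1, h2⟩
    have hL : lower j ≤ y := by
      by_contra hlt
      have hle : lower j ≤ j := by simp only [lower]; split_ifs <;> omega
      refine absurd (h1 ⟨lower j - 1, by omega⟩ ⟨lower j, ?_, ?_, ?_⟩) ?_
      · simp only [lower] at hlt ⊢
        split_ifs at hlt ⊢ <;> omega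
      · change lower j - 1 + 1 ≤ lower j; omega
      · omega
      · change ¬lower j - 1 < y; omega
    refine ⟨hL, ?_⟩
    have hU : y < (if j % 2 = 0 ∧ j ≠ 2 * n + 10 ∧ j ≠ 2 * n + 16 ∧ j ≠ 2 * n + 18
        then j + 4 else j + 3) := by
      by_contra hlt
      split_ifs at hlt with h
      · by_cases hj2 : j + 4 ≤ 2 * n + 20
        · have := h2 ⟨j + 3, by omega⟩ ⟨j + 2, by omega, by simp, by simp⟩
          simp only at this
          omega
        · omega
      · by_cases hj2 : j + 3 ≤ 2 * n + 21
        · have := h2 ⟨j + 2, by omega⟩ ⟨j + 1, by omega, by simp, by simp⟩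
          simp only at this
          omega
        · omega
    simp only [size]
    omega

theorem mergeRel_mem {f : Fin (2 * n + 20) → ℕ}
    (hf : f ∈ windowSeqs (window lower (size n)) (2 * n + 19)) :
    mergeRel f ∈ linearExtensions (TrapezoidPoset n) := by
  obtain ⟨hW, hm⟩ := mem_windowSeqs.1 hf
  have hm' : ∀ j j' : Fin (2 * n + 20), j ≤ j' → f j ≤ f j' := hm
  refine ⟨{ refl := ?_, trans := ?_, antisymm := ?_, total := ?_ }, ?_⟩
  · rintro (i | j) <;> exact le_refl _
  · rintro (i | j) (i' | j') (i'' | j'') h1 h2 <;>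
      simp only [mergeRel, Fin.le_def] at h1 h2 ⊢ <;> try omega
    · exact h1.trans_le (hm' _ _ h2)
    · by_contra h
      exact absurd (hm' j'' j (by rw [Fin.le_def]; omega)) (by omega)
    · exact (hm' _ _ h1).trans h2
  · rintro (i | j) (i' | j') h1 h2 <;> simp only [mergeRel] at h1 h2
    · exact congrArg Sum.inl (le_antisymm h1 h2)
    · omega
    · omega
    · exact congrArg Sum.inr (le_antisymm h1 h2)
  · rintro (i | j) (i' | j') <;> simp only [mergeRel, Fin.le_def] <;> omega
  · rintro (i | j) (i' | j') h
    · exact h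
    · exact ((mem_window_iff j' (f j')).1 (hW j')).2.1 i h
    · exact ((mem_window_iff j (f j)).1 (hW j)).2.2 i' h
    · exact h

theorem mergeRel_injOn :
    Set.InjOn (mergeRel (n := n))
      (windowSeqs (window lower (size n)) (2 * n + 19) : Set (Fin (2 * n + 20) → ℕ)) := by
  intro f hf g hg h
  have hf := ((mem_windowSeqs.1 (Finset.mem_coe.1 hf)).1)
  have hg := ((mem_windowSeqs.1 (Finset.mem_coe.1 hg)).1)
  funext j
  have h1 := ((mem_window_iff j (f j)).1 (hf j)).1
  have h2 := ((mem_window_iff j (g j)).1 (hg j)).1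
  have key : ∀ i : Fin (2 * n + 21), (i : ℕ) < f j ↔ (i : ℕ) < g j := fun i =>
    iff_of_eq (congrFun (congrFun h (Sum.inl i)) (Sum.inr j))
  rcases lt_trichotomy (f j) (g j) with hlt | heq | hlt
  -- The long-chain element of zero-based index `f j` separates the two relations; it exists because
  -- `f j < g j ≤ 2 * n + 21`.
  · have := (key ⟨f j, by omega⟩).2 hlt
    simp at this
  · exact heq
  · have := (key ⟨g j, by omega⟩).1 hlt
    simp at this

theorem exists_mergeRel {r : TrapezoidPoset n → TrapezoidPoset n → Prop}
    (hr : r ∈ linearExtensions (TrapezoidPoset n)) :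
    ∃ f ∈ windowSeqs (window lower (size n)) (2 * n + 19), mergeRel f = r := by
  classical
  obtain ⟨hlin, hext⟩ := hr
  have htrans : ∀ x y z, r x y → r y z → r x z := hlin.trans
  have hanti : ∀ x y, r x y → r y x → x = y := hlin.antisymm
  have htot : ∀ x y, r x y ∨ r y x := hlin.total
  have hll : ∀ i i' : Fin (2 * n + 21), i ≤ i' → r (Sum.inl i) (Sum.inl i') :=
    fun i i' h => hext (Sum.inl i) (Sum.inl i') h
  have hrr : ∀ j j' : Fin (2 * n + 20), j ≤ j' → r (Sum.inr j) (Sum.inr j') :=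
    fun i i' h => hext (Sum.inr i) (Sum.inr i') h
  -- The elements before `b_{j+1}` form an initial segment of the long chain, so membership in `D j`
  -- is decided by its cardinality, which serves as `f j`.
  let D : Fin (2 * n + 20) → Finset (Fin (2 * n + 21)) :=
    fun j => {i | r (Sum.inl i) (Sum.inr j)}
  have hD : ∀ i j, i ∈ D j ↔ r (Sum.inl i) (Sum.inr j) := fun i j => by simp [D]
  have key : ∀ (i : Fin (2 * n + 21)) (j : Fin (2 * n + 20)),
      (i : ℕ) < (D j).card ↔ r (Sum.inl i) (Sum.inr j) := by
    intro i j
    rw [← hD]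
    constructor
    · intro h
      by_contra hi
      have hsub : D j ⊆ Finset.Iio i := by
        intro i' hi'
        rw [Finset.mem_Iio]
        by_contra hle
        exact hi ((hD i j).2 (htrans _ _ _ (hll i i' (not_lt.1 hle)) ((hD i' j).1 hi')))
      have := Finset.card_le_card hsub
      rw [Fin.card_Iio] at this
      omega
    · intro hi
      have hsub : Finset.Iic i ⊆ D j := by
        intro i' hi'
        exact (hD i' j).2 (htrans _ _ _ (hll i' i (Finset.mem_Iic.1 hi')) ((hD i j).1 hi))
      have := Finset.card_le_card hsub
      rw [Fin.card_Iic] at this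
      omega
  have key' : ∀ (i : Fin (2 * n + 21)) (j : Fin (2 * n + 20)),
      (D j).card ≤ (i : ℕ) ↔ r (Sum.inr j) (Sum.inl i) := by
    intro i j
    rw [← not_lt, key]
    constructor
    · intro h
      exact (htot (Sum.inl i) (Sum.inr j)).resolve_left h
    · intro h1 h2
      exact Sum.inl_ne_inr (hanti _ _ h2 h1)
  refine ⟨fun j => (D j).card, mem_windowSeqs.2 ⟨fun j => ?_, fun j j' h => ?_⟩, ?_⟩
  · refine (mem_window_iff j _).2 ⟨?_, fun i h => (key i j).2 (hext _ _ h),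
      fun i h => (key' i j).2 (hext _ _ h)⟩
    simpa using Finset.card_le_univ (D j)
  · refine Finset.card_le_card fun i hi => ?_
    exact (hD i j').2 (htrans _ _ _ ((hD i j).1 hi) (hrr j j' h))
  · funext x y
    apply propext
    rcases x with i | j <;> rcases y with i' | j'
    · refine ⟨fun h => hll i i' h, fun h => ?_⟩
      by_contra hlt
      have h2 := hanti _ _ h (hll i' i (le_of_not_ge hlt))
      exact hlt (Sum.inl_injective h2).le
    · exact key i j'
    · exact key' i' j
    · refine ⟨fun h => hrr j j' h, fun h => ?_⟩
      by_contra hlt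
      have h2 := hanti _ _ h (hrr j' j (le_of_not_ge hlt))
      exact hlt (Sum.inr_injective h2).le

theorem ncard_linearExtensions (q : (TrapezoidPoset n → TrapezoidPoset n → Prop) → Prop)
    (p : (Fin (2 * n + 20) → ℕ) → Prop) [DecidablePred p] (hpq : ∀ f, q (mergeRel f) ↔ p f) :
    {r ∈ linearExtensions (TrapezoidPoset n) | q r}.ncard =
      ((windowSeqs (window lower (size n)) (2 * n + 19)).filter p).card := by
  rw [← Set.ncard_coe_finset, ← Set.InjOn.ncard_image (f := mergeRel (n := n))]
  · congr 1
    ext r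
    simp only [Set.mem_ofPred_eq, Finset.coe_filter, Set.mem_image]
    constructor
    · rintro ⟨hr, hq⟩
      obtain ⟨f, hf, rfl⟩ := exists_mergeRel hr
      exact ⟨f, ⟨hf, (hpq f).1 hq⟩, rfl⟩
    · rintro ⟨f, ⟨hf, hp⟩, rfl⟩
      exact ⟨mergeRel_mem hf, (hpq f).2 hp⟩
  · exact mergeRel_injOn.mono (Finset.coe_subset.2 (Finset.filter_subset _ _))

/-- The number of linear extensions of `T_n` with exactly `lower j + i` elements of the long chain
before `b_{j+1}`. -/
def slotCount (n j i : ℕ) : ℕ :=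
  fwdCount lower (size n) j i * bwdCount lower (size n) (2 * n + 19 - j) j i

theorem card_filter_slot (j : Fin (2 * n + 20)) (p : ℕ → Prop) [DecidablePred p] :
    ((windowSeqs (window lower (size n)) (2 * n + 19)).filter fun f => p (f j)).card =
      ∑ i ∈ Finset.range (size n j), if p (lower j + i) then slotCount n j i else 0 := by
  obtain ⟨j, hj⟩ := j
  obtain ⟨s, hs⟩ : ∃ s, 2 * n + 19 = j + s := ⟨2 * n + 19 - j, by omega⟩
  have h := card_windowSeqs_filter_at lower (size n) j s p
  simp only [slotCount, hs, Nat.add_sub_cancel_left]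
  rw [← h]
  -- The length enters the type of the sequences, so it is made a variable before `2 * n + 19` is
  -- replaced by `j + s`.
  have gen : ∀ (t : ℕ) (e : t = j + s) (hj' : j < t + 1),
      ((windowSeqs (window lower (size n)) t).filter fun f => p (f ⟨j, hj'⟩)).card =
      ((windowSeqs (window lower (size n)) (j + s)).filter
        fun f => p (f ⟨j, by omega⟩)).card := by
    rintro t rfl _
    rfl
  exact gen (2 * n + 19) hs hj

theorem card_linearExtensions (j : Fin (2 * n + 20)) :
    (linearExtensions (TrapezoidPoset n)).ncard =
      ∑ i ∈ Finset.range (size n j), slotCount n j i := by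
  have h := ncard_linearExtensions (n := n) (fun _ => True) (fun _ => True) fun _ => Iff.rfl
  have h2 := card_filter_slot j fun _ => True
  simp only [and_true, if_true] at h h2
  rw [← h2, ← h]
  rfl

theorem probPrec_inl_inr (i : Fin (2 * n + 21)) (j : Fin (2 * n + 20)) :
    probPrec (P := TrapezoidPoset n) (Sum.inl i) (Sum.inr j) =
      ((∑ k ∈ Finset.range (size n j),
        if (i : ℕ) < lower j + k then slotCount n j k else 0 : ℕ) : ℝ)
        / ((linearExtensions (TrapezoidPoset n)).ncard : ℝ) := by
  unfold probPrec
  rw [← card_filter_slot j fun x => (i : ℕ) < x]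
  congr 2
  refine ncard_linearExtensions _ _ fun f => ?_
  exact ⟨fun h => h.2, fun h => ⟨Sum.inl_ne_inr, h⟩⟩

theorem probPrec_inr_inl (i : Fin (2 * n + 21)) (j : Fin (2 * n + 20)) :
    probPrec (P := TrapezoidPoset n) (Sum.inr j) (Sum.inl i) =
      ((∑ k ∈ Finset.range (size n j),
        if lower j + k ≤ (i : ℕ) then slotCount n j k else 0 : ℕ) : ℝ)
        / ((linearExtensions (TrapezoidPoset n)).ncard : ℝ) := by
  unfold probPrec
  rw [← card_filter_slot j fun x => x ≤ (i : ℕ)]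
  congr 2
  refine ncard_linearExtensions _ _ fun f => ?_
  exact ⟨fun h => h.2, fun h => ⟨Sum.inr_ne_inl, h⟩⟩

end TrapezoidPoset

theorem probPrec_eq_zero_of_le {P : Type*} [PartialOrder P] [Finite P] {x y : P} (h : y ≤ x) :
    probPrec x y = 0 := by
  have : {r ∈ linearExtensions P | x ≠ y ∧ r x y} = ∅ := by
    rw [Set.eq_empty_iff_forall_notMem]
    rintro r ⟨⟨hlin, hext⟩, hne, hxy⟩
    exact hne (hlin.antisymm _ _ hxy (hext y x h))
  rw [probPrec, this]
  simp

/-! ### Conditional sums as sums of list prefixes and suffixes -/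

theorem sum_take_map_range (v : ℕ → ℕ) (l t : ℕ) :
    (((List.range l).map v).take t).sum = ∑ k ∈ Finset.range l, if k < t then v k else 0 := by
  induction l with
  | zero => simp
  | succ l ih =>
    rw [List.range_succ, List.map_append, List.take_append, List.sum_append, ih,
      Finset.sum_range_succ]
    congr 1
    rcases lt_or_ge l t with h | h
    · obtain ⟨k, hk⟩ : ∃ k, t - l = k + 1 := ⟨t - l - 1, by omega⟩
      simp [h, hk]
    · simp [Nat.sub_eq_zero_of_le h, not_lt.2 h]

theorem sum_drop_map_range (v : ℕ → ℕ) (l t : ℕ) :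
    (((List.range l).map v).drop t).sum = ∑ k ∈ Finset.range l, if t ≤ k then v k else 0 := by
  have h1 := List.sum_take_add_sum_drop ((List.range l).map v) t
  have h2 : ((List.range l).map v).sum = ∑ k ∈ Finset.range l, v k := by
    have := sum_take_map_range v l l
    rw [List.take_of_length_le (by simp)] at this
    rw [this]
    exact Finset.sum_congr rfl fun k hk => if_pos (Finset.mem_range.1 hk)
  have h3 : (∑ k ∈ Finset.range l, if k < t then v k else 0) +
      (∑ k ∈ Finset.range l, if t ≤ k then v k else 0) = ∑ k ∈ Finset.range l, v k := by
    rw [← Finset.sum_add_distrib]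
    refine Finset.sum_congr rfl fun k _ => ?_
    by_cases h : k < t
    · simp [h, not_le.2 h]
    · simp [h, not_lt.1 h]
  rw [sum_take_map_range] at h1
  omega

/-! ### Explicit forward and backward rows -/

namespace TrapezoidPoset

variable {n : ℕ}

/-- The values of `fwdCount` on the `j`-th window of `T_n`. -/
def fwdRow (n j : ℕ) : List ℕ := (List.range (size n j)).map (fwdCount lower (size n) j)

/-- The values of `bwdCount` on the `j`-th window of `T_n`. -/
def bwdRow (n s j : ℕ) : List ℕ := (List.range (size n j)).map (bwdCount lower (size n) s j)

/-- The values of `slotCount` on the `j`-th window of `T_n`. -/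
def slotRow (n j : ℕ) : List ℕ := (List.range (size n j)).map (slotCount n j)

theorem size_of_le {j : ℕ} (hj : j ≤ 2 * n + 9) :
    size n j = (if j % 2 = 0 then j + 4 else j + 3) - lower j := by
  simp only [size]
  split_ifs <;> omega

theorem fwdRow_zero : fwdRow n 0 = List.replicate (size n 0) 1 := by
  simp only [fwdRow]
  exact List.eq_replicate_iff.2 ⟨by simp, by simp [fwdCount]⟩

theorem bwdRow_zero (j : ℕ) : bwdRow n 0 j = List.replicate (size n j) 1 := by
  simp only [bwdRow]
  exact List.eq_replicate_iff.2 ⟨by simp, by simp [bwdCount]⟩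

/-- With `d` the shift between the two window starts, slot `k` precedes slot `i` of the next window
iff `k < d + i + 1`. New entries are therefore prefix sums of the old row. -/
theorem fwdRow_succ {j : ℕ} {L : List ℕ} (d l : ℕ) (h : fwdRow n j = L)
    (hd : lower (j + 1) = lower j + d) (hl : size n (j + 1) = l) :
    fwdRow n (j + 1) = (List.range l).map fun i => (L.take (d + i + 1)).sum := by
  subst h hl
  refine List.map_congr_left fun i _ => ?_
  rw [fwdRow, sum_take_map_range, fwdCount]
  refine Finset.sum_congr rfl fun k _ => ?_
  congr 1
  exact propext ⟨fun h => by omega, fun h => by omega⟩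

/-- The same comparison reads `i - d ≤ k`; truncated subtraction is right here, since for `i ≤ d`
every slot is allowed. -/
theorem bwdRow_succ {s j : ℕ} {L : List ℕ} (d l : ℕ) (h : bwdRow n s (j + 1) = L)
    (hd : lower (j + 1) = lower j + d) (hl : size n j = l) :
    bwdRow n (s + 1) j = (List.range l).map fun i => (L.drop (i - d)).sum := by
  subst h hl
  refine List.map_congr_left fun i _ => ?_
  rw [bwdRow, sum_drop_map_range, bwdCount]
  refine Finset.sum_congr rfl fun k _ => ?_
  congr 1
  exact propext ⟨fun h => by omega, fun h => by omega⟩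

theorem slotRow_eq {j s : ℕ} {L L' : List ℕ} (hf : fwdRow n j = L) (hb : bwdRow n s j = L')
    (hs : 2 * n + 19 = j + s) : slotRow n j = List.zipWith (· * ·) L L' := by
  subst hf hb
  rw [fwdRow, bwdRow, List.zipWith_map, List.zipWith_self]
  refine List.map_congr_left fun i _ => ?_
  rw [slotCount, hs, Nat.add_sub_cancel_left]

theorem fwdRow_at_zero : fwdRow n 0 = [1, 1, 1, 1] := by
  rw [fwdRow_zero, show size n 0 = 4 from
    (size_of_le (by omega)).trans rfl]
  rfl

theorem fwdRow_at_one : fwdRow n 1 = [2, 3, 4] :=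
  fwdRow_succ 1 3 fwdRow_at_zero rfl ((size_of_le (by omega)).trans rfl)

theorem fwdRow_at_two : fwdRow n 2 = [5, 9, 9, 9] :=
  fwdRow_succ 1 4 fwdRow_at_one rfl ((size_of_le (by omega)).trans rfl)

theorem fwdRow_at_three : fwdRow n 3 = [14, 23, 32] :=
  fwdRow_succ 1 3 fwdRow_at_two rfl ((size_of_le (by omega)).trans rfl)

theorem fwdRow_at_four : fwdRow n 4 = [37, 69, 69, 69] :=
  fwdRow_succ 1 4 fwdRow_at_three rfl ((size_of_le (by omega)).trans rfl)

theorem fwdRow_at_five : fwdRow n 5 = [37, 106, 175, 244] :=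
  fwdRow_succ 0 4 fwdRow_at_four rfl ((size_of_le (by omega)).trans rfl)

theorem fwdRow_at_six : fwdRow n 6 = [318, 562, 562, 562] :=
  fwdRow_succ 2 4 fwdRow_at_five rfl ((size_of_le (by omega)).trans rfl)

theorem fwdRow_at_seven : fwdRow n 7 = [318, 880, 1442, 2004] :=
  fwdRow_succ 0 4 fwdRow_at_six rfl ((size_of_le (by omega)).trans rfl)

theorem fwdRow_at_eight : fwdRow n 8 = [2640, 4644, 4644, 4644] :=
  fwdRow_succ 2 4 fwdRow_at_seven rfl ((size_of_le (by omega)).trans rfl)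

theorem fwdRow_at_nine : fwdRow n 9 = [7284, 11928, 16572] :=
  fwdRow_succ 1 3 fwdRow_at_eight rfl ((size_of_le (by omega)).trans rfl)

theorem bwdRow_fuel_zero : bwdRow n 0 (2 * n + 19) = [1, 1, 1, 1] := by
  rw [bwdRow_zero, show size n (2 * n + 19) = 4 from
    by simp only [size, lower]; split_ifs <;> omega]
  rfl

theorem bwdRow_fuel_one : bwdRow n 1 (2 * n + 18) = [4, 3, 2] :=
  bwdRow_succ (j := 2 * n + 18) 0 3 bwdRow_fuel_zero
    (by simp only [lower]; split_ifs <;> omega) (by simp only [size, lower]; split_ifs <;> omega)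

theorem bwdRow_fuel_two : bwdRow n 2 (2 * n + 17) = [9, 9, 9, 5] :=
  bwdRow_succ (j := 2 * n + 17) 2 4 bwdRow_fuel_one
    (by simp only [lower]; split_ifs <;> omega) (by simp only [size, lower]; split_ifs <;> omega)

theorem bwdRow_fuel_three : bwdRow n 3 (2 * n + 16) = [32, 23, 14] :=
  bwdRow_succ (j := 2 * n + 16) 0 3 bwdRow_fuel_two
    (by simp only [lower]; split_ifs <;> omega) (by simp only [size, lower]; split_ifs <;> omega)

theorem bwdRow_fuel_four : bwdRow n 4 (2 * n + 15) = [69, 69, 69, 37] :=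
  bwdRow_succ (j := 2 * n + 15) 2 4 bwdRow_fuel_three
    (by simp only [lower]; split_ifs <;> omega) (by simp only [size, lower]; split_ifs <;> omega)

theorem bwdRow_fuel_five : bwdRow n 5 (2 * n + 14) = [244, 175, 106, 37] :=
  bwdRow_succ (j := 2 * n + 14) 0 4 bwdRow_fuel_four
    (by simp only [lower]; split_ifs <;> omega) (by simp only [size, lower]; split_ifs <;> omega)

theorem bwdRow_fuel_six : bwdRow n 6 (2 * n + 13) = [562, 562, 562, 318] :=
  bwdRow_succ (j := 2 * n + 13) 2 4 bwdRow_fuel_five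
    (by simp only [lower]; split_ifs <;> omega) (by simp only [size, lower]; split_ifs <;> omega)

theorem bwdRow_fuel_seven : bwdRow n 7 (2 * n + 12) = [2004, 1442, 880, 318] :=
  bwdRow_succ (j := 2 * n + 12) 0 4 bwdRow_fuel_six
    (by simp only [lower]; split_ifs <;> omega) (by simp only [size, lower]; split_ifs <;> omega)

theorem bwdRow_fuel_eight : bwdRow n 8 (2 * n + 11) = [4644, 4644, 4644, 2640] :=
  bwdRow_succ (j := 2 * n + 11) 2 4 bwdRow_fuel_seven
    (by simp only [lower]; split_ifs <;> omega) (by simp only [size, lower]; split_ifs <;> omega)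

theorem bwdRow_fuel_nine : bwdRow n 9 (2 * n + 10) = [16572, 11928, 7284] :=
  bwdRow_succ (j := 2 * n + 10) 0 3 bwdRow_fuel_eight
    (by simp only [lower]; split_ifs <;> omega) (by simp only [size, lower]; split_ifs <;> omega)

/-- For `n = 0` this would be the exceptional window 9, which has only three slots. The entries are
the starting pair `(a_1, b_1)`, mirrored. -/
theorem bwdRow_fuel_ten (hn : 1 ≤ n) : bwdRow n 10 (2 * n + 9) = [35784, 35784, 35784, 19212] :=
  bwdRow_succ (j := 2 * n + 9) 2 4 bwdRow_fuel_nine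
    (by simp only [lower]; split_ifs <;> omega) (by simp only [size, lower]; split_ifs <;> omega)

theorem fwdRow_odd_of_even {m x y : ℕ} (h1 : 1 ≤ m)
    (h : fwdRow n (2 * m + 8) = [x, y, y, y]) :
    fwdRow n (2 * m + 9) = [x, x + y, x + 2 * y, x + 3 * y] := by
  rw [fwdRow_succ (j := 2 * m + 8) 0 4 h (by simp only [lower]; split_ifs <;> omega)
    (by simp only [size, lower]; split_ifs <;> omega)]
  simp [List.range_succ]
  omega

/-- Two transfers across one trapezoid yield the recursion matrix. At `m = n` the extra edge
`b_{2n+11} < a_{2n+13}` removes the last slot. -/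
theorem fwdRow_even_of_odd {m x y : ℕ} (h1 : 1 ≤ m) (hn : m ≤ n)
    (h : fwdRow n (2 * m + 9) = [x, x + y, x + 2 * y, x + 3 * y]) :
    fwdRow n (2 * m + 10) =
      if m = n then [3 * x + 3 * y, 4 * x + 6 * y, 4 * x + 6 * y]
      else [3 * x + 3 * y, 4 * x + 6 * y, 4 * x + 6 * y, 4 * x + 6 * y] := by
  split_ifs with hmn
  · rw [fwdRow_succ (j := 2 * m + 9) 2 3 h (by simp only [lower]; split_ifs <;> omega)
      (by simp only [size, lower]; split_ifs <;> omega)]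
    simp [List.range_succ]
    omega
  · rw [fwdRow_succ (j := 2 * m + 9) 2 4 h (by simp only [lower]; split_ifs <;> omega)
      (by simp only [size, lower]; split_ifs <;> omega)]
    simp [List.range_succ]
    omega

theorem bwdRow_even_of_odd {m s u w : ℕ} (h1 : 1 ≤ m) (hn : m ≤ n)
    (h : bwdRow n s (2 * m + 9) = [u, u, u, w]) :
    bwdRow n (s + 1) (2 * m + 8) = [3 * u + w, 2 * u + w, u + w, w] := by
  rw [bwdRow_succ (j := 2 * m + 8) 0 4 h (by simp only [lower]; split_ifs <;> omega)
    (by simp only [size, lower]; split_ifs <;> omega)]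
  simp [List.range_succ]
  omega

/-- At `m = 0` the extra edge `a_9 < b_{10}` raises the start of window 9 by one, leaving three
slots. -/
theorem bwdRow_odd_of_even {m s u w : ℕ} (hn : m < n)
    (h : bwdRow n s (2 * m + 10) = [3 * u + w, 2 * u + w, u + w, w]) :
    bwdRow n (s + 1) (2 * m + 9) =
      if m = 0 then [4 * w + 6 * u, 4 * w + 6 * u, 3 * w + 3 * u]
      else [4 * w + 6 * u, 4 * w + 6 * u, 4 * w + 6 * u, 3 * w + 3 * u] := by
  split_ifs with hm
  · rw [bwdRow_succ (j := 2 * m + 9) 1 3 h (by simp only [lower]; split_ifs <;> omega)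
      (by simp only [size, lower]; split_ifs <;> omega)]
    simp [List.range_succ]
    omega
  · rw [bwdRow_succ (j := 2 * m + 9) 2 4 h (by simp only [lower]; split_ifs <;> omega)
      (by simp only [size, lower]; split_ifs <;> omega)]
    simp [List.range_succ]
    omega

/-- The recursion satisfied by the entries of the rows in the middle part of `T_n`. -/
structure RowRecursion (a b : ℕ → ℕ) : Prop where
  a_one : a 1 = 19212
  b_one : b 1 = 35784
  a_succ : ∀ m, 1 ≤ m → a (m + 1) = 3 * a m + 3 * b m
  b_succ : ∀ m, 1 ≤ m → b (m + 1) = 4 * a m + 6 * b m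

/-- The cone `7/4 ≤ b/a ≤ 2` is invariant under the recursion. It is narrow enough for all later
comparisons of cuts. -/
theorem RowRecursion.bounds {a b : ℕ → ℕ} (R : RowRecursion a b) {m : ℕ} (hm : 1 ≤ m) :
    7 * a m ≤ 4 * b m ∧ b m ≤ 2 * a m ∧ 0 < a m := by
  induction m, hm using Nat.le_induction with
  | base => rw [R.a_one, R.b_one]; omega
  | succ m hm ih => rw [R.a_succ m hm, R.b_succ m hm]; omega

variable {a b : ℕ → ℕ}

theorem fwdRow_even (R : RowRecursion a b) {m : ℕ} (h1 : 1 ≤ m) (hn : m ≤ n) :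
    fwdRow n (2 * m + 8) = [a m, b m, b m, b m] := by
  induction m, h1 using Nat.le_induction with
  | base =>
    rw [R.a_one, R.b_one]
    exact fwdRow_succ 1 4 fwdRow_at_nine rfl ((size_of_le (by omega)).trans rfl)
  | succ m hm ih =>
    have h := fwdRow_even_of_odd hm (by omega) (fwdRow_odd_of_even hm (ih (by omega)))
    rwa [if_neg (by omega), ← R.a_succ m hm, ← R.b_succ m hm] at h

theorem fwdRow_odd (R : RowRecursion a b) {m : ℕ} (h1 : 1 ≤ m) (hn : m ≤ n) :
    fwdRow n (2 * m + 9) = [a m, a m + b m, a m + 2 * b m, a m + 3 * b m] :=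
  fwdRow_odd_of_even h1 (fwdRow_even R h1 hn)

/-- Backwards, the recursion index counts trapezoids from the upper end, hence `k + 1` with `n = m +
k`. -/
theorem bwdRow_odd (R : RowRecursion a b) {m k : ℕ} (h1 : 1 ≤ m) (hn : n = m + k) :
    bwdRow n (2 * k + 10) (2 * m + 9) = [b (k + 1), b (k + 1), b (k + 1), a (k + 1)] := by
  induction k generalizing m with
  | zero =>
    obtain rfl : n = m := hn
    rw [R.a_one, R.b_one]
    exact bwdRow_fuel_ten h1
  | succ k ih =>
    have h := bwdRow_odd_of_even (m := m) (by omega)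
      (bwdRow_even_of_odd (m := m + 1) (by omega) (by omega) (ih (by omega) (by omega)))
    rwa [if_neg (by omega), ← R.a_succ _ (by omega), ← R.b_succ _ (by omega)] at h

theorem bwdRow_even (R : RowRecursion a b) {m k : ℕ} (h1 : 1 ≤ m) (hn : n = m + k) :
    bwdRow n (2 * k + 11) (2 * m + 8) = [3 * b (k + 1) + a (k + 1), 2 * b (k + 1) + a (k + 1),
      b (k + 1) + a (k + 1), a (k + 1)] :=
  bwdRow_even_of_odd h1 (by omega) (bwdRow_odd R h1 hn)

/-! ### Forward rows in the upper end piece and their mirror images in the lower one -/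

theorem fwdRow_end_zero (R : RowRecursion a b) (hn : 1 ≤ n) :
    fwdRow n (2 * n + 10) =[a (n + 1), b (n + 1), b (n + 1)] := by
  have h := fwdRow_even_of_odd hn le_rfl (fwdRow_odd R hn le_rfl)
  rwa [if_pos rfl, ← R.a_succ n hn, ← R.b_succ n hn] at h

theorem fwdRow_end_one (R : RowRecursion a b) (hn : 1 ≤ n) :
    fwdRow n (2 * n + 11) =
      [a (n + 1), a (n + 1) + b (n + 1), a (n + 1) + 2 * b (n + 1), a (n + 1) + 2 * b (n + 1)] := by
  rw [fwdRow_succ (j := 2 * n + 10) 0 4 (fwdRow_end_zero R hn)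
    (by simp only [lower]; split_ifs <;> omega) (by simp only [size, lower]; split_ifs <;> omega)]
  simp [List.range_succ]
  omega

theorem fwdRow_end_two (R : RowRecursion a b) (hn : 1 ≤ n) :
    fwdRow n (2 * n + 12) =
      [3 * a (n + 1) + 3 * b (n + 1), 4 * a (n + 1) + 5 * b (n + 1),
        4 * a (n + 1) + 5 * b (n + 1), 4 * a (n + 1) + 5 * b (n + 1)] := by
  rw [fwdRow_succ (j := 2 * n + 11) 2 4 (fwdRow_end_one R hn)
    (by simp only [lower]; split_ifs <;> omega) (by simp only [size, lower]; split_ifs <;> omega)]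
  simp [List.range_succ]
  omega

theorem fwdRow_end_three (R : RowRecursion a b) (hn : 1 ≤ n) :
    fwdRow n (2 * n + 13) =
      [3 * a (n + 1) + 3 * b (n + 1), 7 * a (n + 1) + 8 * b (n + 1),
        11 * a (n + 1) + 13 * b (n + 1), 15 * a (n + 1) + 18 * b (n + 1)] := by
  rw [fwdRow_succ (j := 2 * n + 12) 0 4 (fwdRow_end_two R hn)
    (by simp only [lower]; split_ifs <;> omega) (by simp only [size, lower]; split_ifs <;> omega)]
  simp [List.range_succ]
  omega

theorem fwdRow_end_four (R : RowRecursion a b) (hn : 1 ≤ n) :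
    fwdRow n (2 * n + 14) =
      [21 * a (n + 1) + 24 * b (n + 1), 36 * a (n + 1) + 42 * b (n + 1),
        36 * a (n + 1) + 42 * b (n + 1), 36 * a (n + 1) + 42 * b (n + 1)] := by
  rw [fwdRow_succ (j := 2 * n + 13) 2 4 (fwdRow_end_three R hn)
    (by simp only [lower]; split_ifs <;> omega) (by simp only [size, lower]; split_ifs <;> omega)]
  simp [List.range_succ]
  omega

theorem fwdRow_end_five (R : RowRecursion a b) (hn : 1 ≤ n) :
    fwdRow n (2 * n + 15) =
      [21 * a (n + 1) + 24 * b (n + 1), 57 * a (n + 1) + 66 * b (n + 1),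
        93 * a (n + 1) + 108 * b (n + 1), 129 * a (n + 1) + 150 * b (n + 1)] := by
  rw [fwdRow_succ (j := 2 * n + 14) 0 4 (fwdRow_end_four R hn)
    (by simp only [lower]; split_ifs <;> omega) (by simp only [size, lower]; split_ifs <;> omega)]
  simp [List.range_succ]
  omega

theorem fwdRow_end_six (R : RowRecursion a b) (hn : 1 ≤ n) :
    fwdRow n (2 * n + 16) =
      [171 * a (n + 1) + 198 * b (n + 1), 300 * a (n + 1) + 348 * b (n + 1),
        300 * a (n + 1) + 348 * b (n + 1)] := by
  rw [fwdRow_succ (j := 2 * n + 15) 2 3 (fwdRow_end_five R hn)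
    (by simp only [lower]; split_ifs <;> omega) (by simp only [size, lower]; split_ifs <;> omega)]
  simp [List.range_succ]
  omega

theorem fwdRow_end_seven (R : RowRecursion a b) (hn : 1 ≤ n) :
    fwdRow n (2 * n + 17) =
      [171 * a (n + 1) + 198 * b (n + 1), 471 * a (n + 1) + 546 * b (n + 1),
        771 * a (n + 1) + 894 * b (n + 1), 771 * a (n + 1) + 894 * b (n + 1)] := by
  rw [fwdRow_succ (j := 2 * n + 16) 0 4 (fwdRow_end_six R hn)
    (by simp only [lower]; split_ifs <;> omega) (by simp only [size, lower]; split_ifs <;> omega)]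
  simp [List.range_succ]
  omega

theorem fwdRow_end_eight (R : RowRecursion a b) (hn : 1 ≤ n) :
    fwdRow n (2 * n + 18) =
      [1413 * a (n + 1) + 1638 * b (n + 1), 2184 * a (n + 1) + 2532 * b (n + 1),
        2184 * a (n + 1) + 2532 * b (n + 1)] := by
  rw [fwdRow_succ (j := 2 * n + 17) 2 3 (fwdRow_end_seven R hn)
    (by simp only [lower]; split_ifs <;> omega) (by simp only [size, lower]; split_ifs <;> omega)]
  simp [List.range_succ]
  omega

theorem fwdRow_end_nine (R : RowRecursion a b) (hn : 1 ≤ n) :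
    fwdRow n (2 * n + 19) =
      [1413 * a (n + 1) + 1638 * b (n + 1), 3597 * a (n + 1) + 4170 * b (n + 1),
        5781 * a (n + 1) + 6702 * b (n + 1), 5781 * a (n + 1) + 6702 * b (n + 1)] := by
  rw [fwdRow_succ (j := 2 * n + 18) 0 4 (fwdRow_end_eight R hn)
    (by simp only [lower]; split_ifs <;> omega) (by simp only [size, lower]; split_ifs <;> omega)]
  simp [List.range_succ]
  omega

theorem bwdRow_start_nine (R : RowRecursion a b) (hn : 1 ≤ n) :
    bwdRow n (2 * n + 10) 9 =[b (n + 1), b (n + 1), a (n + 1)] := by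
  obtain ⟨k, rfl⟩ : ∃ k, n = k + 1 := ⟨n - 1, by omega⟩
  have h := bwdRow_odd_of_even (n := k + 1) (m := 0) (by omega)
      (bwdRow_even R (m := 1) (k := k) le_rfl (by omega))
  rw [if_pos rfl, ← R.a_succ _ (by omega), ← R.b_succ _ (by omega)] at h
  rw [show 2 * (k + 1) + 10 = 2 * k + 11 + 1 by ring]
  exact h

theorem bwdRow_start_eight (R : RowRecursion a b) (hn : 1 ≤ n) :
    bwdRow n (2 * n + 11) 8 =
      [a (n + 1) + 2 * b (n + 1), a (n + 1) + 2 * b (n + 1), a (n + 1) + b (n + 1), a (n + 1)] := by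
  rw [bwdRow_succ (s := 2 * n + 10) (j := 8) 1 4 (bwdRow_start_nine R hn)
    rfl ((size_of_le (by omega)).trans rfl)]
  simp [List.range_succ]
  omega

theorem bwdRow_start_seven (R : RowRecursion a b) (hn : 1 ≤ n) :
    bwdRow n (2 * n + 12) 7 =
      [4 * a (n + 1) + 5 * b (n + 1), 4 * a (n + 1) + 5 * b (n + 1),
        4 * a (n + 1) + 5 * b (n + 1), 3 * a (n + 1) + 3 * b (n + 1)] := by
  rw [bwdRow_succ (s := 2 * n + 11) (j := 7) 2 4 (bwdRow_start_eight R hn)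
    rfl ((size_of_le (by omega)).trans rfl)]
  simp [List.range_succ]
  omega

theorem bwdRow_start_six (R : RowRecursion a b) (hn : 1 ≤ n) :
    bwdRow n (2 * n + 13) 6 =
      [15 * a (n + 1) + 18 * b (n + 1), 11 * a (n + 1) + 13 * b (n + 1),
        7 * a (n + 1) + 8 * b (n + 1), 3 * a (n + 1) + 3 * b (n + 1)] := by
  rw [bwdRow_succ (s := 2 * n + 12) (j := 6) 0 4 (bwdRow_start_seven R hn)
    rfl ((size_of_le (by omega)).trans rfl)]
  simp [List.range_succ]
  omega

theorem bwdRow_start_five (R : RowRecursion a b) (hn : 1 ≤ n) :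
    bwdRow n (2 * n + 14) 5 =
      [36 * a (n + 1) + 42 * b (n + 1), 36 * a (n + 1) + 42 * b (n + 1),
        36 * a (n + 1) + 42 * b (n + 1), 21 * a (n + 1) + 24 * b (n + 1)] := by
  rw [bwdRow_succ (s := 2 * n + 13) (j := 5) 2 4 (bwdRow_start_six R hn)
    rfl ((size_of_le (by omega)).trans rfl)]
  simp [List.range_succ]
  omega

theorem bwdRow_start_four (R : RowRecursion a b) (hn : 1 ≤ n) :
    bwdRow n (2 * n + 15) 4 =
      [129 * a (n + 1) + 150 * b (n + 1), 93 * a (n + 1) + 108 * b (n + 1),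
        57 * a (n + 1) + 66 * b (n + 1), 21 * a (n + 1) + 24 * b (n + 1)] := by
  rw [bwdRow_succ (s := 2 * n + 14) (j := 4) 0 4 (bwdRow_start_five R hn)
    rfl ((size_of_le (by omega)).trans rfl)]
  simp [List.range_succ]
  omega

theorem bwdRow_start_three (R : RowRecursion a b) (hn : 1 ≤ n) :
    bwdRow n (2 * n + 16) 3 =
      [300 * a (n + 1) + 348 * b (n + 1), 300 * a (n + 1) + 348 * b (n + 1),
        171 * a (n + 1) + 198 * b (n + 1)] := by
  rw [bwdRow_succ (s := 2 * n + 15) (j := 3) 1 3 (bwdRow_start_four R hn)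
    rfl ((size_of_le (by omega)).trans rfl)]
  simp [List.range_succ]
  omega

theorem bwdRow_start_two (R : RowRecursion a b) (hn : 1 ≤ n) :
    bwdRow n (2 * n + 17) 2 =
      [771 * a (n + 1) + 894 * b (n + 1), 771 * a (n + 1) + 894 * b (n + 1),
        471 * a (n + 1) + 546 * b (n + 1), 171 * a (n + 1) + 198 * b (n + 1)] := by
  rw [bwdRow_succ (s := 2 * n + 16) (j := 2) 1 4 (bwdRow_start_three R hn)
    rfl ((size_of_le (by omega)).trans rfl)]
  simp [List.range_succ]
  omega

theorem bwdRow_start_one (R : RowRecursion a b) (hn : 1 ≤ n) :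
    bwdRow n (2 * n + 18) 1 =
      [2184 * a (n + 1) + 2532 * b (n + 1), 2184 * a (n + 1) + 2532 * b (n + 1),
        1413 * a (n + 1) + 1638 * b (n + 1)] := by
  rw [bwdRow_succ (s := 2 * n + 17) (j := 1) 1 3 (bwdRow_start_two R hn)
    rfl ((size_of_le (by omega)).trans rfl)]
  simp [List.range_succ]
  omega

theorem bwdRow_start_zero (R : RowRecursion a b) (hn : 1 ≤ n) :
    bwdRow n (2 * n + 19) 0 =
      [5781 * a (n + 1) + 6702 * b (n + 1), 5781 * a (n + 1) + 6702 * b (n + 1),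
        3597 * a (n + 1) + 4170 * b (n + 1), 1413 * a (n + 1) + 1638 * b (n + 1)] := by
  rw [bwdRow_succ (s := 2 * n + 18) (j := 0) 1 4 (bwdRow_start_one R hn)
    rfl ((size_of_le (by omega)).trans rfl)]
  simp [List.range_succ]
  omega

end TrapezoidPoset

/-! ### Bounding every cut of every row -/

/-- Cutting the list `z` at any place leaves a part with sum at most `X`. -/
def CutsBounded (X : ℕ) (z : List ℕ) : Prop := ∀ t, min (z.take t).sum (z.drop t).sum ≤ X

theorem cutsBounded_three {X p q r : ℕ} (h1 : p ≤ X ∨ q + r ≤ X) (h2 : p + q ≤ X ∨ r ≤ X) :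
    CutsBounded X [p, q, r]
  | 0 => by simp
  | 1 => by simpa using h1
  | 2 => by simpa using h2
  | t + 3 => by simp

theorem cutsBounded_four {X p q r s : ℕ} (h1 : p ≤ X ∨ q + (r + s) ≤ X)
    (h2 : p + q ≤ X ∨ r + s ≤ X) (h3 : p + (q + r) ≤ X ∨ s ≤ X) :
    CutsBounded X [p, q, r, s]
  | 0 => by simp
  | 1 => by simpa using h1
  | 2 => by simpa using h2
  | 3 => by simpa using h3
  | t + 4 => by simp

namespace TrapezoidPoset

variable {n : ℕ} {a b : ℕ → ℕ}

theorem sum_slotRow (j : ℕ) (hj : j < 2 * n + 20) :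
    (slotRow n j).sum = (linearExtensions (TrapezoidPoset n)).ncard := by
  rw [card_linearExtensions ⟨j, hj⟩, slotRow]
  have := sum_take_map_range (slotCount n j) (size n j) (size n j)
  rw [List.take_of_length_le (by simp)] at this
  rw [this]
  exact Finset.sum_congr rfl fun k hk => if_pos (Finset.mem_range.1 hk)

theorem probPrec_inl_inr_eq (i : Fin (2 * n + 21)) (j : Fin (2 * n + 20)) :
    probPrec (P := TrapezoidPoset n) (Sum.inl i) (Sum.inr j) =
      (((slotRow n j).drop (i + 1 - lower j)).sum : ℕ) /
        ((linearExtensions (TrapezoidPoset n)).ncard : ℝ) := by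
  rw [probPrec_inl_inr, slotRow, sum_drop_map_range]
  congr 2
  refine Finset.sum_congr rfl fun k _ => ?_
  congr 1
  exact propext ⟨fun h => by omega, fun h => by omega⟩

theorem probPrec_inr_inl_eq (i : Fin (2 * n + 21)) (j : Fin (2 * n + 20)) :
    probPrec (P := TrapezoidPoset n) (Sum.inr j) (Sum.inl i) =
      (((slotRow n j).take (i + 1 - lower j)).sum : ℕ) /
        ((linearExtensions (TrapezoidPoset n)).ncard : ℝ) := by
  rw [probPrec_inr_inl, slotRow, sum_take_map_range]
  congr 2
  refine Finset.sum_congr rfl fun k _ => ?_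
  congr 1
  exact propext ⟨fun h => by omega, fun h => by omega⟩

theorem slotRow_last (R : RowRecursion a b) (hn : 1 ≤ n) :
    slotRow n (2 * n + 19) = [1413 * a (n + 1) + 1638 * b (n + 1),
      3597 * a (n + 1) + 4170 * b (n + 1), 5781 * a (n + 1) + 6702 * b (n + 1),
      5781 * a (n + 1) + 6702 * b (n + 1)] := by
  rw [slotRow_eq (fwdRow_end_nine R hn) bwdRow_fuel_zero rfl]
  simp

theorem ncard_linearExtensions_eq (R : RowRecursion a b) (hn : 1 ≤ n) :
    (linearExtensions (TrapezoidPoset n)).ncard = 16572 * a (n + 1) + 19212 * b (n + 1) := by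
  rw [← sum_slotRow (2 * n + 19) (by omega), slotRow_last R hn]
  simp
  omega

theorem cutsBounded_slotRow_start (R : RowRecursion a b) (hn : 1 ≤ n) {j : ℕ} (hj : j < 10) :
    CutsBounded (5781 * a (n + 1) + 6702 * b (n + 1)) (slotRow n j) := by
  obtain ⟨h1, h2, -⟩ := R.bounds (m := n + 1) (by omega)
  interval_cases j
  · rw [slotRow_eq fwdRow_at_zero (bwdRow_start_zero R hn) (by ring)]
    simp only [List.zipWith_cons_cons, List.zipWith_nil_left]
    exact cutsBounded_four (by omega) (by omega) (by omega)
  · rw [slotRow_eq fwdRow_at_one (bwdRow_start_one R hn) (by ring)]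
    simp only [List.zipWith_cons_cons, List.zipWith_nil_left]
    exact cutsBounded_three (by omega) (by omega)
  · rw [slotRow_eq fwdRow_at_two (bwdRow_start_two R hn) (by ring)]
    simp only [List.zipWith_cons_cons, List.zipWith_nil_left]
    exact cutsBounded_four (by omega) (by omega) (by omega)
  · rw [slotRow_eq fwdRow_at_three (bwdRow_start_three R hn) (by ring)]
    simp only [List.zipWith_cons_cons, List.zipWith_nil_left]
    exact cutsBounded_three (by omega) (by omega)
  · rw [slotRow_eq fwdRow_at_four (bwdRow_start_four R hn) (by ring)]
    simp only [List.zipWith_cons_cons, List.zipWith_nil_left]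
    exact cutsBounded_four (by omega) (by omega) (by omega)
  · rw [slotRow_eq fwdRow_at_five (bwdRow_start_five R hn) (by ring)]
    simp only [List.zipWith_cons_cons, List.zipWith_nil_left]
    exact cutsBounded_four (by omega) (by omega) (by omega)
  · rw [slotRow_eq fwdRow_at_six (bwdRow_start_six R hn) (by ring)]
    simp only [List.zipWith_cons_cons, List.zipWith_nil_left]
    exact cutsBounded_four (by omega) (by omega) (by omega)
  · rw [slotRow_eq fwdRow_at_seven (bwdRow_start_seven R hn) (by ring)]
    simp only [List.zipWith_cons_cons, List.zipWith_nil_left]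
    exact cutsBounded_four (by omega) (by omega) (by omega)
  · rw [slotRow_eq fwdRow_at_eight (bwdRow_start_eight R hn) (by ring)]
    simp only [List.zipWith_cons_cons, List.zipWith_nil_left]
    exact cutsBounded_four (by omega) (by omega) (by omega)
  · rw [slotRow_eq fwdRow_at_nine (bwdRow_start_nine R hn) (by ring)]
    simp only [List.zipWith_cons_cons, List.zipWith_nil_left]
    exact cutsBounded_three (by omega) (by omega)

theorem cutsBounded_slotRow_end (R : RowRecursion a b) (hn : 1 ≤ n) {k : ℕ} (hk : k < 10) :
    CutsBounded (5781 * a (n + 1) + 6702 * b (n + 1)) (slotRow n (2 * n + 10 + k)) := by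
  obtain ⟨h1, h2, -⟩ := R.bounds (m := n + 1) (by omega)
  interval_cases k
  · rw [slotRow_eq (fwdRow_end_zero R hn) bwdRow_fuel_nine (by ring)]
    simp only [List.zipWith_cons_cons, List.zipWith_nil_left]
    exact cutsBounded_three (by omega) (by omega)
  · rw [slotRow_eq (fwdRow_end_one R hn) bwdRow_fuel_eight (by ring)]
    simp only [List.zipWith_cons_cons, List.zipWith_nil_left]
    exact cutsBounded_four (by omega) (by omega) (by omega)
  · rw [slotRow_eq (fwdRow_end_two R hn) bwdRow_fuel_seven (by ring)]
    simp only [List.zipWith_cons_cons, List.zipWith_nil_left]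
    exact cutsBounded_four (by omega) (by omega) (by omega)
  · rw [slotRow_eq (fwdRow_end_three R hn) bwdRow_fuel_six (by ring)]
    simp only [List.zipWith_cons_cons, List.zipWith_nil_left]
    exact cutsBounded_four (by omega) (by omega) (by omega)
  · rw [slotRow_eq (fwdRow_end_four R hn) bwdRow_fuel_five (by ring)]
    simp only [List.zipWith_cons_cons, List.zipWith_nil_left]
    exact cutsBounded_four (by omega) (by omega) (by omega)
  · rw [slotRow_eq (fwdRow_end_five R hn) bwdRow_fuel_four (by ring)]
    simp only [List.zipWith_cons_cons, List.zipWith_nil_left]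
    exact cutsBounded_four (by omega) (by omega) (by omega)
  · rw [slotRow_eq (fwdRow_end_six R hn) bwdRow_fuel_three (by ring)]
    simp only [List.zipWith_cons_cons, List.zipWith_nil_left]
    exact cutsBounded_three (by omega) (by omega)
  · rw [slotRow_eq (fwdRow_end_seven R hn) bwdRow_fuel_two (by ring)]
    simp only [List.zipWith_cons_cons, List.zipWith_nil_left]
    exact cutsBounded_four (by omega) (by omega) (by omega)
  · rw [slotRow_eq (fwdRow_end_eight R hn) bwdRow_fuel_one (by ring)]
    simp only [List.zipWith_cons_cons, List.zipWith_nil_left]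
    exact cutsBounded_three (by omega) (by omega)
  · rw [slotRow_eq (fwdRow_end_nine R hn) bwdRow_fuel_zero (by ring)]
    simp only [List.zipWith_cons_cons, List.zipWith_nil_left]
    exact cutsBounded_four (by omega) (by omega) (by omega)

theorem cutsBounded_slotRow_middle (R : RowRecursion a b) {m k : ℕ} (hm : 1 ≤ m)
    (hn : n = m + k) :
    CutsBounded (5781 * a (n + 1) + 6702 * b (n + 1)) (slotRow n (2 * m + 9)) ∧
      CutsBounded (5781 * a (n + 1) + 6702 * b (n + 1)) (slotRow n (2 * m + 8)) := by
  -- Since `5781 * 19212 ≤ 16572 * 6702`, the target fraction is at least `5781 / 16572`. Writing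
  -- the total as the sum of the current row then leaves an inequality in that row's own entries.
  have hX : 5781 * (linearExtensions (TrapezoidPoset n)).ncard ≤
      16572 * (5781 * a (n + 1) + 6702 * b (n + 1)) := by
    rw [ncard_linearExtensions_eq R (by omega)]
    omega
  have hodd : slotRow n (2 * m + 9) = _ :=
    slotRow_eq (fwdRow_odd R hm (by omega)) (bwdRow_odd R hm hn) (by omega)
  have heven : slotRow n (2 * m + 8) = _ :=
    slotRow_eq (fwdRow_even R hm (by omega)) (bwdRow_even R hm hn) (by omega)
  rw [← sum_slotRow (2 * m + 9) (by omega), hodd] at hX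
  rw [hodd, heven]
  simp only [List.zipWith_cons_cons, List.zipWith_nil_left, List.sum_cons, List.sum_nil] at hX ⊢
  generalize 5781 * a (n + 1) + 6702 * b (n + 1) = X at hX ⊢
  obtain ⟨h1, h2, -⟩ := R.bounds hm
  obtain ⟨h3, h4, -⟩ := R.bounds (m := k + 1) (by omega)
  generalize a m = x at *
  generalize b m = y at *
  generalize a (k + 1) = w at *
  generalize b (k + 1) = u at *
  -- Multiplying each ratio bound by an entry of the other pair gives linear relations among the
  -- four monomials `x * u`, `x * w`, `y * u`, `y * w`, so linear arithmetic suffices.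
  have e1 := Nat.mul_le_mul_right u h1
  have e2 := Nat.mul_le_mul_right u h2
  have e3 := Nat.mul_le_mul_right w h1
  have e4 := Nat.mul_le_mul_right w h2
  have e5 := Nat.mul_le_mul_left x h3
  have e6 := Nat.mul_le_mul_left x h4
  have e7 := Nat.mul_le_mul_left y h3
  have e8 := Nat.mul_le_mul_left y h4
  constructor
  · refine cutsBounded_four (Or.inl ?_) (Or.inl ?_) (Or.inr ?_) <;> linarith
  · refine cutsBounded_four (Or.inl ?_) (Or.inr ?_) (Or.inr ?_) <;> linarith

theorem cutsBounded_slotRow (R : RowRecursion a b) (hn : 1 ≤ n) {j : ℕ} (hj : j < 2 * n + 20) :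
    CutsBounded (5781 * a (n + 1) + 6702 * b (n + 1)) (slotRow n j) := by
  rcases lt_or_ge j 10 with h | h
  · exact cutsBounded_slotRow_start R hn h
  rcases lt_or_ge j (2 * n + 10) with h' | h'
  · rcases Nat.even_or_odd' j with ⟨t, rfl | rfl⟩
    · obtain ⟨m, rfl⟩ : ∃ m, t = m + 4 := ⟨t - 4, by omega⟩
      exact (cutsBounded_slotRow_middle R (m := m) (k := n - m) (by omega) (by omega)).2
    · obtain ⟨m, rfl⟩ : ∃ m, t = m + 4 := ⟨t - 4, by omega⟩
      exact (cutsBounded_slotRow_middle R (m := m) (k := n - m) (by omega) (by omega)).1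
  · obtain ⟨k, rfl⟩ := Nat.exists_eq_add_of_le h'
    exact cutsBounded_slotRow_end R hn (by omega)

/-! ### The value of the balance constant -/

theorem min_probPrec_le (R : RowRecursion a b) (hn : 1 ≤ n) (i : Fin (2 * n + 21))
    (j : Fin (2 * n + 20)) :
    min (probPrec (P := TrapezoidPoset n) (Sum.inl i) (Sum.inr j))
      (probPrec (P := TrapezoidPoset n) (Sum.inr j) (Sum.inl i)) ≤
      (5781 * (a (n + 1) : ℝ) + 6702 * (b (n + 1) : ℝ)) /
        (16572 * (a (n + 1) : ℝ) + 19212 * (b (n + 1) : ℝ)) := by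
  have h := (Nat.cast_le (α := ℝ)).2 (cutsBounded_slotRow R hn j.2 (i + 1 - lower j))
  rw [Nat.cast_min] at h
  rw [probPrec_inl_inr_eq, probPrec_inr_inl_eq, ncard_linearExtensions_eq R hn,
    min_div_div_right (by positivity), min_comm]
  refine (div_le_div_of_nonneg_right h (Nat.cast_nonneg _)).trans_eq ?_
  push_cast
  rfl

theorem balanceConstant_eq (R : RowRecursion a b) (hn : 1 ≤ n) :
    balanceConstant (TrapezoidPoset n) =
      (5781 * (a (n + 1) : ℝ) + 6702 * (b (n + 1) : ℝ)) /
        (16572 * (a (n + 1) : ℝ) + 19212 * (b (n + 1) : ℝ)) := by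
  apply le_antisymm
  · refine Finset.sup'_le _ _ ?_
    have hcomp : ∀ x y : TrapezoidPoset n, x ≤ y → min (probPrec x y) (probPrec y x) ≤
        (5781 * (a (n + 1) : ℝ) + 6702 * (b (n + 1) : ℝ)) /
          (16572 * (a (n + 1) : ℝ) + 19212 * (b (n + 1) : ℝ)) := fun x y h => by
      rw [probPrec_eq_zero_of_le h]
      exact (min_le_right _ _).trans (by positivity)
    rintro ⟨i | j, i' | j'⟩ -
    · rcases le_total i i' with h | h
      · exact hcomp (Sum.inl i) (Sum.inl i') h
      · rw [min_comm]
        exact hcomp (Sum.inl i') (Sum.inl i) h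
    · exact min_probPrec_le R hn i j'
    · rw [min_comm]
      exact min_probPrec_le R hn i' j
    · rcases le_total j j' with h | h
      · exact hcomp (Sum.inr j) (Sum.inr j') h
      · rw [min_comm]
        exact hcomp (Sum.inr j') (Sum.inr j) h
  · let i : Fin (2 * n + 21) := ⟨2 * n + 20, by omega⟩
    let j : Fin (2 * n + 20) := ⟨2 * n + 19, by omega⟩
    -- For the two top elements, the window starts at `2 * n + 18`, so the cut isolates the last of
    -- its four slots.
    have hl : (i : ℕ) + 1 - lower j = 3 := by
      change 2 * n + 20 + 1 - lower (2 * n + 19) = 3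
      simp only [lower]
      split_ifs <;> omega
    refine le_trans (le_min ?_ ?_) (Finset.le_sup'
      (f := fun p : TrapezoidPoset n × TrapezoidPoset n =>
        min (probPrec p.1 p.2) (probPrec p.2 p.1)) (Finset.mem_univ (Sum.inl i, Sum.inr j)))
    · change _ ≤ probPrec (P := TrapezoidPoset n) (Sum.inl i) (Sum.inr j)
      rw [probPrec_inl_inr_eq, hl, slotRow_last R hn, ncard_linearExtensions_eq R hn]
      apply le_of_eq
      simp
    -- The third slot equals the fourth, so the left part already reaches the target.
    · change _ ≤ probPrec (P := TrapezoidPoset n) (Sum.inr j) (Sum.inl i)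
      rw [probPrec_inr_inl_eq, hl, slotRow_last R hn, ncard_linearExtensions_eq R hn]
      have ha0 : (0 : ℝ) ≤ a (n + 1) := Nat.cast_nonneg _
      have hb0 : (0 : ℝ) ≤ b (n + 1) := Nat.cast_nonneg _
      simp only [List.take_succ_cons, List.take_zero, List.sum_cons, List.sum_nil]
      push_cast
      refine div_le_div_of_nonneg_right ?_ (by positivity)
      linarith

/-! ### Width and chain decomposition -/

theorem hasWidth_two (n : ℕ) : HasWidth (TrapezoidPoset n) 2 := by
  classical
  constructor
  · let x : TrapezoidPoset n := Sum.inl 0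
    let y : TrapezoidPoset n := Sum.inr 0
    have hxy : x ≠ y := Sum.inl_ne_inr
    have h1 : ¬ x ≤ y := by
      rintro ⟨k, -, hk, hk'⟩
      simp at hk hk'
      omega
    have h2 : ¬ y ≤ x := by
      rintro ⟨k, -, hk, hk'⟩
      simp at hk hk'
    refine ⟨{x, y}, ?_, Finset.card_pair hxy⟩
    rw [Finset.coe_pair]
    exact isAntichain_insert.2 ⟨Set.pairwise_singleton _ _, by
      rintro z rfl -
      exact ⟨h1, h2⟩⟩
  · rintro m ⟨s, hs, rfl⟩
    by_contra hlt
    -- Pigeonhole: among three elements two lie in the same chain and are comparable.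
    let side : TrapezoidPoset n → Bool := Sum.isLeft
    obtain ⟨x, hx, y, hy, hne, hxy⟩ := Finset.exists_ne_map_eq_of_card_lt_of_maps_to
      (s := s) (t := (Finset.univ : Finset Bool)) (by simpa using hlt) (f := side)
      (fun _ _ => Finset.mem_coe.2 (Finset.mem_univ _))
    have hle : x ≤ y ∨ y ≤ x := by
      rcases x with i | j <;> rcases y with i' | j'
      · exact le_total i i'
      · simp [side] at hxy
      · simp [side] at hxy
      · exact le_total j j'
    rcases hle with h | h
    · exact hs hx hy hne h
    · exact hs hy hx hne.symm h

theorem exists_two_chains (n : ℕ) :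
    ∃ A B : Set (TrapezoidPoset n),
      IsChain (· ≤ ·) A ∧ IsChain (· ≤ ·) B ∧ A ∪ B = Set.univ ∧ Disjoint A B ∧
        A.ncard = 2 * n + 21 ∧ B.ncard = 2 * n + 20 := by
  refine ⟨Set.range (Sum.inl : Fin (2 * n + 21) → Fin (2 * n + 21) ⊕ Fin (2 * n + 20)),
    Set.range (Sum.inr : Fin (2 * n + 20) → Fin (2 * n + 21) ⊕ Fin (2 * n + 20)),
    ?_, ?_, Set.range_inl_union_range_inr,
    Set.isCompl_range_inl_range_inr.disjoint, ?_, ?_⟩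
  · rintro _ ⟨i, rfl⟩ _ ⟨i', rfl⟩ -
    exact le_total i i'
  · rintro _ ⟨j, rfl⟩ _ ⟨j', rfl⟩ -
    exact le_total j j'
  · refine (Set.ncard_range_of_injective Sum.inl_injective).trans ?_
    simp
  · refine (Set.ncard_range_of_injective Sum.inr_injective).trans ?_
    simp

/-! ### The limit -/

/-- The pair sequence with `RowRecursion`, indexed from zero. -/
def rowPair : ℕ → ℕ × ℕ
  | 0 => (19212, 35784)
  | m + 1 => (3 * (rowPair m).1 + 3 * (rowPair m).2, 4 * (rowPair m).1 + 6 * (rowPair m).2)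

theorem rowRecursion_rowPair :
    RowRecursion (fun m => (rowPair (m - 1)).1) (fun m => (rowPair (m - 1)).2) where
  a_one := rfl
  b_one := rfl
  a_succ m hm := by
    obtain ⟨k, rfl⟩ := Nat.exists_eq_add_of_le' hm
    rfl
  b_succ m hm := by
    obtain ⟨k, rfl⟩ := Nat.exists_eq_add_of_le' hm
    rfl

open Filter Topology in
-- With `r` the limit ratio, `b - r * a` is multiplied by the smaller eigenvalue `6 - 3 * r` at each
-- step. That eigenvalue has modulus below one, while `a ≥ 1`.
theorem RowRecursion.tendsto_ratio (R : RowRecursion a b) :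
    Tendsto (fun n => (b (n + 1) : ℝ) / a (n + 1)) atTop (𝓝 ((3 + √57) / 6)) := by
  have hsq : √57 * √57 = 57 := Real.mul_self_sqrt (by norm_num)
  have h7 : (7 : ℝ) < √57 := Real.lt_sqrt_of_sq_lt (by norm_num)
  have h8 : √57 < 8 := (Real.sqrt_lt' (by norm_num)).2 (by norm_num)
  set r : ℝ := (3 + √57) / 6 with hr
  have hgeom : ∀ n, (b (n + 1) : ℝ) - r * a (n + 1) = (6 - 3 * r) ^ n * (b 1 - r * a 1) := by
    intro n
    induction n with
    | zero => simp
    | succ n ih =>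
      rw [R.a_succ (n + 1) (by omega), R.b_succ (n + 1) (by omega), pow_succ]
      push_cast
      -- Equivalent to `3 * r ^ 2 = 3 * r + 4`, the fixed-point equation of the ratio `b/a`.
      have h : (4 : ℝ) - 3 * r = -r * (6 - 3 * r) := by rw [hr]; nlinarith
      linear_combination (6 - 3 * r) * ih + (a (n + 1) : ℝ) * h
  have hpos : ∀ n, (1 : ℝ) ≤ a (n + 1) := fun n => by
    exact_mod_cast (R.bounds (m := n + 1) (by omega)).2.2
  have hlim : Tendsto (fun n => ((b (n + 1) : ℝ) - r * a (n + 1)) / a (n + 1)) atTop (𝓝 0) := by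
    have h0 : Tendsto (fun n : ℕ => |6 - 3 * r| ^ n * |(b 1 : ℝ) - r * a 1|) atTop (𝓝 0) := by
      have := (tendsto_pow_atTop_nhds_zero_of_lt_one (abs_nonneg (6 - 3 * r))
        (abs_lt.2 ⟨by rw [hr]; linarith, by rw [hr]; linarith⟩)).mul_const |(b 1 : ℝ) - r * a 1|
      simpa using this
    refine squeeze_zero_norm (fun n => ?_) h0
    rw [hgeom, Real.norm_eq_abs, abs_div, abs_mul, abs_pow]
    refine div_le_self (by positivity) ?_
    rw [abs_of_nonneg (by positivity)]
    exact hpos n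
  have := hlim.add_const r
  rw [zero_add] at this
  refine this.congr fun n => ?_
  have := hpos n
  have h0 : (a (n + 1) : ℝ) ≠ 0 := by positivity
  field_simp
  ring

open Filter Topology in
theorem tendsto_balanceConstant :
    Tendsto (fun n : ℕ => balanceConstant (TrapezoidPoset n)) atTop
      (𝓝 ((5864893 + 27 * √57) / 16812976)) := by
  have R := rowRecursion_rowPair
  have hsq : √57 * √57 = 57 := Real.mul_self_sqrt (by norm_num)
  have hs := R.tendsto_ratio
  have hpos : (0 : ℝ) < 16572 + 19212 * ((3 + √57) / 6) := by positivity
  -- Numerator and denominator are divided by `a (n + 1)`, so only the ratio `b/a` remains.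
  have hlim := ((hs.const_mul 6702).const_add 5781).div
    ((hs.const_mul 19212).const_add 16572) hpos.ne'
  have hval : (5781 + 6702 * ((3 + √57) / 6)) / (16572 + 19212 * ((3 + √57) / 6)) =
      (5864893 + 27 * √57) / 16812976 := by
    rw [div_eq_div_iff hpos.ne' (by norm_num)]
    linarith
  rw [hval] at hlim
  refine hlim.congr' ?_
  filter_upwards [eventually_ge_atTop 1] with n hn
  rw [balanceConstant_eq R hn]
  have h0 : (0 : ℝ) < ((rowPair (n + 1 - 1)).1 : ℝ) := by
    exact_mod_cast (R.bounds (m := n + 1) (by omega)).2.2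
  simp only [Pi.div_apply]
  have h1 : (0 : ℝ) ≤ ((rowPair (n + 1 - 1)).2 : ℝ) := Nat.cast_nonneg _
  field_simp

end TrapezoidPoset

open TrapezoidPoset in
theorem theorem1p2 :
    (∀ n : ℕ, 1 ≤ n →
      HasWidth (TrapezoidPoset n) 2 ∧
      ∃ A B : Set (TrapezoidPoset n),
        IsChain (· ≤ ·) A ∧ IsChain (· ≤ ·) B ∧ A ∪ B = Set.univ ∧ Disjoint A B ∧
          A.ncard = 2 * n + 21 ∧ B.ncard = 2 * n + 20) ∧
    (∀ a b : ℕ → ℕ, a 1 = 19212 → b 1 = 35784 →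
      (∀ m, 1 ≤ m → a (m + 1) = 3 * a m + 3 * b m) →
      (∀ m, 1 ≤ m → b (m + 1) = 4 * a m + 6 * b m) →
      ∀ n : ℕ, 1 ≤ n →
        balanceConstant (TrapezoidPoset n) =
          (5781 * (a (n + 1) : ℝ) + 6702 * (b (n + 1) : ℝ)) /
            (16572 * (a (n + 1) : ℝ) + 19212 * (b (n + 1) : ℝ))) ∧
    Filter.Tendsto (fun n : ℕ => balanceConstant (TrapezoidPoset n)) Filter.atTop
      (nhds ((5864893 + 27 * Real.sqrt 57) / 16812976)) ∧
    (0.348843 : ℝ) < (5864893 + 27 * Real.sqrt 57) / 16812976 ∧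
    (5864893 + 27 * Real.sqrt 57) / 16812976 < (0.348844 : ℝ) := by
  have h7 : (7.5 : ℝ) < √57 := Real.lt_sqrt_of_sq_lt (by norm_num)
  have h8 : √57 < 7.6 := (Real.sqrt_lt' (by norm_num)).2 (by norm_num)
  refine ⟨fun n _ => ⟨hasWidth_two n, exists_two_chains n⟩,
    fun a b h1 h2 h3 h4 n hn => balanceConstant_eq ⟨h1, h2, h3, h4⟩ hn,
    tendsto_balanceConstant, ?_, ?_⟩
  · rw [lt_div_iff₀ (by norm_num)]
    norm_num at h7 ⊢
    linarith
  · rw [div_lt_iff₀ (by norm_num)]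
    norm_num at h8 ⊢
    linarith
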